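/- **Theorem (No divergence-based reverse data-processing inequality on all states).** Let $\mathcal F$ be the set of functions $f:(0,\infty)\to\mathbb R$ that are operator convex (i.e. $f(tA+(1-t)B)\le t f(A)+(1-t)f(B)$ in the Loewner order for all positive definite $A,B\in\mathbb C^{d\times d}$, all $d\in\mathbb N$ and $t\in(0,1)$) with $f(1)=0$ and $f''(1)>0$. For $f\in\mathcal F$, a *monotone quantum $f$-divergence* $D_f$ assigns, in every dimension $d$, an extended real number $D_f(\rho\|\gamma)$ to each pair of density operators $\rho,\gamma$ on $\mathbb C^d$ with equal support (the support of an operator being the orthogonal complement of its kernel), such that * (classical reduction) if $\rho=U\,\mathrm{diag}(p)\,U^\dagger$ and $\gamma=U\,\mathrm{diag}(q)\,U^\dagger$ with $U$ unitary and $p,q$ probability vectors having the same zeros, then $D_f(\rho\|\gamma)=\sum_{y:\,q_y>0} q_y f(p_y/q_y)$; * (data processing) $D_f(\Phi(\rho)\|\Phi(\gamma))\le D_f(\rho\|\gamma)$ for every quantum channel (completely positive trace-preserving linear map) $\Phi$ between finite-dimensional matrix algebras and all such $\rho,\gamma$. Let $f\in\mathcal F$, let $D_f$ be any monotone quantum $f$-divergence,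 and let $\mathcal N:\mathcal B(\mathbb C^{d_A})\to\mathcal B(\mathbb C^{d_B})$ be a quantum channel with $d_B\le d_A$ and $d_A\ge 2$. Then the expansion coefficient of $\mathcal N$ over all states, $$\check\eta_f(\mathcal N):=\inf_{\substack{\rho\ne\gamma\\ \mathrm{supp}\,\rho=\mathrm{supp}\,\gamma}}\frac{D_f(\mathcal N(\rho)\|\mathcal N(\gamma))}{D_f(\rho\|\gamma)},$$ where $\rho,\gamma$ range over density operators on $\mathbb C^{d_A}$, equals $1$ if $\mathcal N$ is a unitary channel (that is, $d_A=d_B$ and $\mathcal N(X)=UXU^\dagger$ for some unitary $U$), and equals $0$ otherwise. -/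

import Mathlib

namespace QFDiv

noncomputable section

open scoped ComplexOrder

/-- Operators on the Hilbert space `ℂ^d`. -/
abbrev Op (d : ℕ) : Type := Matrix (Fin d) (Fin d) ℂ

/-- The density operators on `ℂ^d`: positive semidefinite with trace one. -/
def densityOps (d : ℕ) : Set (Op d) :=
  {ρ | ρ.PosSemidef ∧ ρ.trace = 1}

/-- The support of an operator: the orthogonal complement of its kernel. -/
def supp {d : ℕ} (A : Op d) : Submodule ℂ (EuclideanSpace ℂ (Fin d)) :=
  (LinearMap.ker (Matrix.toEuclideanLin A))ᗮ

/-- The amplification `id_k ⊗ N`: apply `N` to each of the `k × k` blocks of `X`. -/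
def amplify {a b : ℕ} (N : Op a →ₗ[ℂ] Op b) (k : ℕ)
    (X : Matrix (Fin k × Fin a) (Fin k × Fin a) ℂ) :
    Matrix (Fin k × Fin b) (Fin k × Fin b) ℂ :=
  Matrix.of fun p q => N (X.submatrix (Prod.mk p.1) (Prod.mk q.1)) p.2 q.2

/-- Quantum channels: completely positive trace-preserving linear maps. -/
structure IsQuantumChannel {a b : ℕ} (N : Op a →ₗ[ℂ] Op b) : Prop where
  completelyPositive : ∀ (k : ℕ) (X : Matrix (Fin k × Fin a) (Fin k × Fin a) ℂ),
    X.PosSemidef → (amplify N k X).PosSemidef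
  tracePreserving : ∀ X : Op a, (N X).trace = X.trace

/-- Unitary channels: the dimensions agree and `N X = U X U†` for a unitary `U`. -/
def IsUnitaryChannel {a b : ℕ} (N : Op a →ₗ[ℂ] Op b) : Prop :=
  a = b ∧ ∃ U : Matrix (Fin b) (Fin a) ℂ,
    U.conjTranspose * U = 1 ∧ U * U.conjTranspose = 1 ∧
      ∀ X : Op a, N X = U * X * U.conjTranspose

/-- Operator convexity of `f` on `(0, ∞)`: on positive definite matrices of every size,
`f (t A + (1 - t) B) ≤ t f(A) + (1 - t) f(B)` in the Loewner order, where `f(A)` is given by the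
functional calculus. Only the values of `f` on `(0, ∞)` matter. -/
def OperatorConvex (f : ℝ → ℝ) : Prop :=
  ∀ (d : ℕ) (A B : Op d), A.PosDef → B.PosDef → ∀ t ∈ Set.Ioo (0 : ℝ) 1,
    (t • cfc f A + (1 - t) • cfc f B - cfc f (t • A + (1 - t) • B)).PosSemidef

/-- The class of functions generating the divergences: operator convex on `(0, ∞)`,
with `f(1) = 0` and `f''(1) > 0`. -/
structure ClassF (f : ℝ → ℝ) : Prop where
  operatorConvex : OperatorConvex f
  map_one : f 1 = 0
  deriv_two_pos : 0 < deriv (deriv f) 1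

/-- The classical `f`-divergence. It is used for `p`, `q` with the same zeros; the summands
with `p y = q y = 0` then vanish. -/
def classicalFDiv (f : ℝ → ℝ) {d : ℕ} (p q : Fin d → ℝ) : ℝ :=
  ∑ y, q y * f (p y / q y)

/-- A monotone quantum `f`-divergence, as a family of extended-real-valued functions of pairs of
states of equal support, one for each dimension (values at other pairs are irrelevant):
it reduces to the classical `f`-divergence on commuting pairs, and it satisfies the
data-processing inequality under all quantum channels. -/
structure IsMonotoneFDivergence (f : ℝ → ℝ) (D : (d : ℕ) → Op d → Op d → EReal) : Prop where
  classical : ∀ (d : ℕ) (p q : Fin d → ℝ),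
    p ∈ stdSimplex ℝ (Fin d) → q ∈ stdSimplex ℝ (Fin d) → (∀ y, p y = 0 ↔ q y = 0) →
    ∀ U ∈ Matrix.unitaryGroup (Fin d) ℂ,
      D d (U * Matrix.diagonal (fun y => (p y : ℂ)) * U.conjTranspose)
          (U * Matrix.diagonal (fun y => (q y : ℂ)) * U.conjTranspose) =
        (classicalFDiv f p q : EReal)
  monotone : ∀ (a b : ℕ) (N : Op a →ₗ[ℂ] Op b), IsQuantumChannel N →
    ∀ ρ ∈ densityOps a, ∀ γ ∈ densityOps a, supp ρ = supp γ →
      D b (N ρ) (N γ) ≤ D a ρ γ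

/-- The expansion coefficient of `N` over all pairs of distinct states of equal support. -/
def expansionCoeff (D : (d : ℕ) → Op d → Op d → EReal) {a b : ℕ} (N : Op a →ₗ[ℂ] Op b) : EReal :=
  sInf {r | ∃ ρ ∈ densityOps a, ∃ γ ∈ densityOps a, ρ ≠ γ ∧ supp ρ = supp γ ∧
    r = D b (N ρ) (N γ) / D a ρ γ}

end

end QFDiv

namespace QFDiv

open scoped ComplexOrder Topology Kronecker
open Matrix

/-! Nothing is known about `D` on noncommuting pairs, so it is only compared with classical binary
divergences `binDiv`. A two-outcome measurement bounds `D` from below, and preparing two states from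
a coin bounds it from above.

Vanishing criterion (`expansionCoeff_nonpos`): let α, β be perfectly distinguishable states with N β
≤ C · N α. Compare (1-2ε)α + 2εβ with (1-ε)α + εβ. The inputs sit near the end of a segment, where
measuring gives a divergence of at least a constant times ε. The output segment extends beyond N α
inside the state space, so the outputs are mixtures with weights near an interior point. There the
binary divergence has zero derivative and is o(ε), so the ratio tends to 0.

If the coefficient is not zero, the criterion must fail for every orthonormal family
(`exists_notMem_span`): each added basis vector strictly enlarges the span of the Kraus images.
These spans lie in ℂ^b with b ≤ a, so the first one has dimension at most 1 (`exists_line`). Since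
any vector can come first, the Kraus operators send each vector into a line, and this forces them to
be proportional (`exists_kraus_eq_smul`). Trace preservation then makes the channel unitary.

Conversely, a unitary channel has an inverse channel, so data processing in both directions gives
ratio 1. -/

open scoped MatrixOrder in
theorem exists_eq_conjTranspose_mul_self {n : Type*} [Fintype n] {A : Matrix n n ℂ}
    (hA : A.PosSemidef) : ∃ B : Matrix n n ℂ, A = Bᴴ * B := by
  classical
  exact CStarAlgebra.nonneg_iff_eq_star_mul_self.mp hA.nonneg

/-! ### Kraus form of channels; measure-and-prepare channels -/

/-- The completely positive map `X ↦ ∑ k, K k * X * (K k)ᴴ` with Kraus operators `K`. -/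
def krausMap {ι : Type*} [Fintype ι] {a b : ℕ} (K : ι → Matrix (Fin b) (Fin a) ℂ) :
    Op a →ₗ[ℂ] Op b where
  toFun X := ∑ k, K k * X * (K k)ᴴ
  map_add' X Y := by simp [Matrix.mul_add, Matrix.add_mul, Finset.sum_add_distrib]
  map_smul' c X := by simp [Finset.smul_sum]

theorem krausMap_apply {ι : Type*} [Fintype ι] {a b : ℕ} (K : ι → Matrix (Fin b) (Fin a) ℂ)
    (X : Op a) : krausMap K X = ∑ k, K k * X * (K k)ᴴ := rfl

theorem one_kronecker_conj_apply {a b k : ℕ} (K : Matrix (Fin b) (Fin a) ℂ)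
    (X : Matrix (Fin k × Fin a) (Fin k × Fin a) ℂ) (p q : Fin k × Fin b) :
    (((1 : Matrix (Fin k) (Fin k) ℂ) ⊗ₖ K) * X * ((1 : Matrix (Fin k) (Fin k) ℂ) ⊗ₖ K)ᴴ) p q =
      (K * X.submatrix (Prod.mk p.1) (Prod.mk q.1) * Kᴴ) p.2 q.2 := by
  simp [Matrix.mul_apply, Fintype.sum_prod_type, Matrix.one_apply, Finset.sum_ite_eq,
    Finset.sum_mul, ite_mul, mul_ite, apply_ite star]

theorem amplify_krausMap {ι : Type*} [Fintype ι] {a b : ℕ}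
    (K : ι → Matrix (Fin b) (Fin a) ℂ) (k : ℕ) (X : Matrix (Fin k × Fin a) (Fin k × Fin a) ℂ) :
    amplify (krausMap K) k X = ∑ i, ((1 : Matrix (Fin k) (Fin k) ℂ) ⊗ₖ K i) * X *
      ((1 : Matrix (Fin k) (Fin k) ℂ) ⊗ₖ K i)ᴴ := by
  ext p q
  rw [Matrix.sum_apply]
  simp_rw [one_kronecker_conj_apply]
  simp [amplify, krausMap_apply, Matrix.sum_apply]

theorem krausMap_isQuantumChannel {ι : Type*} [Fintype ι] {a b : ℕ}
    (K : ι → Matrix (Fin b) (Fin a) ℂ) (hK : ∑ k, (K k)ᴴ * K k = 1) :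
    IsQuantumChannel (krausMap K) where
  completelyPositive k X hX := by
    rw [amplify_krausMap]
    exact Matrix.posSemidef_sum _ fun i _ => hX.mul_mul_conjTranspose_same _
  tracePreserving X := by
    have h : ∀ k, (K k * X * (K k)ᴴ).trace = ((K k)ᴴ * K k * X).trace := fun k => by
      rw [Matrix.trace_mul_cycle]
    rw [krausMap_apply, Matrix.trace_sum]
    simp_rw [h]
    rw [← Matrix.trace_sum, ← Finset.sum_mul, hK, one_mul]

/-- **Choi–Kraus.** -/
theorem IsQuantumChannel.exists_kraus {a b : ℕ} {N : Op a →ₗ[ℂ] Op b} (hN : IsQuantumChannel N) :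
    ∃ K : Fin a × Fin b → Matrix (Fin b) (Fin a) ℂ, N = krausMap K := by
  -- `vᴴ * v` is the unnormalised projector onto ∑ eᵢ ⊗ eᵢ, so its amplified image is the Choi
  -- matrix; the rows of a factor `B` of it yield the Kraus operators.
  let v : Matrix (Fin 1) (Fin a × Fin a) ℂ := Matrix.of fun _ x => if x.1 = x.2 then 1 else 0
  have hC := hN.completelyPositive a _ (Matrix.posSemidef_conjTranspose_mul_self v)
  obtain ⟨B, hB⟩ := exists_eq_conjTranspose_mul_self hC
  have key : ∀ i j p q, N (Matrix.single i j 1) p q = ∑ k, star (B k (i, p)) * B k (j, q) := by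
    intro i j p q
    have h1 : (amplify N a (vᴴ * v)) (i, p) (j, q) = N (Matrix.single i j 1) p q := by
      have : (vᴴ * v).submatrix (Prod.mk i) (Prod.mk j) = Matrix.single i j (1 : ℂ) := by
        ext x y
        simp [v, Matrix.mul_apply, Matrix.single_apply, ← ite_and, apply_ite star]
        congr 1
        simp [and_comm]
      simp [amplify, this]
    rw [← h1, hB]
    simp [Matrix.mul_apply]
  refine ⟨fun k => Matrix.of fun p i => star (B k (i, p)), ?_⟩
  apply Matrix.ext_linearMap
  intro i j
  apply LinearMap.ext_ring
  ext p q
  simp only [LinearMap.comp_apply, Matrix.singleLinearMap_apply, key, krausMap_apply,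
    Matrix.sum_apply]
  refine Finset.sum_congr rfl fun k _ => ?_
  simp [Matrix.mul_apply, Matrix.single_apply, ite_and]

/-- A completely positive map in Kraus form: `X ↦ tr (E X) T`, for `E` and `T` positive
semidefinite. -/
theorem exists_kraus_trace_smul {a b : ℕ} {E : Op a} {T : Op b} (hE : E.PosSemidef)
    (hT : T.PosSemidef) : ∃ K : Fin b × Fin a → Matrix (Fin b) (Fin a) ℂ,
      (∀ X, krausMap K X = (E * X).trace • T) ∧ ∑ k, (K k)ᴴ * K k = T.trace • E := by
  obtain ⟨F, rfl⟩ := exists_eq_conjTranspose_mul_self hE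
  obtain ⟨S, rfl⟩ := exists_eq_conjTranspose_mul_self hT
  have hS : ∑ n, vecMulVec (star (S.row n)) (S.row n) = Sᴴ * S := by
    ext p q
    simp [Matrix.sum_apply, vecMulVec_apply, Matrix.mul_apply]
  have hF : ∑ m, vecMulVec (star (F.row m)) (F.row m) = Fᴴ * F := by
    ext p q
    simp [Matrix.sum_apply, vecMulVec_apply, Matrix.mul_apply]
  -- Rank-one Kraus operators: rows of `F` resolve the effect `E`, rows of `S` resolve the state
  -- `T`.
  refine ⟨fun k => vecMulVec (star (S.row k.1)) (F.row k.2), fun X => ?_, ?_⟩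
  · have h1 : ∀ k : Fin b × Fin a, vecMulVec (star (S.row k.1)) (F.row k.2) * X *
        (vecMulVec (star (S.row k.1)) (F.row k.2))ᴴ =
        ((F.row k.2 ᵥ* X) ⬝ᵥ star (F.row k.2)) • vecMulVec (star (S.row k.1)) (S.row k.1) :=
      fun k => by
      rw [conjTranspose_vecMulVec, Matrix.vecMulVec_mul, vecMulVec_mul_vecMulVec, star_star,
        vecMulVec_smul]
    have h2 : (Fᴴ * F * X).trace = ∑ m, (F.row m ᵥ* X) ⬝ᵥ star (F.row m) := by
      rw [Matrix.mul_assoc, Matrix.trace_mul_comm]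
      rfl
    rw [krausMap_apply, Fintype.sum_prod_type_right]
    rw [h2, Finset.sum_smul]
    refine Finset.sum_congr rfl fun m _ => ?_
    rw [Finset.sum_congr rfl fun n _ => h1 _, ← hS, Finset.smul_sum]
  · have h1 : ∀ k : Fin b × Fin a, (vecMulVec (star (S.row k.1)) (F.row k.2))ᴴ *
        vecMulVec (star (S.row k.1)) (F.row k.2) =
        (S.row k.1 ⬝ᵥ star (S.row k.1)) • vecMulVec (star (F.row k.2)) (F.row k.2) := fun k => by
      rw [conjTranspose_vecMulVec, vecMulVec_mul_vecMulVec, star_star, vecMulVec_smul]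
    have h2 : (Sᴴ * S).trace = ∑ m, S.row m ⬝ᵥ star (S.row m) := by
      rw [Matrix.trace_mul_comm]
      rfl
    rw [Fintype.sum_prod_type]
    rw [h2, Finset.sum_smul]
    refine Finset.sum_congr rfl fun m _ => ?_
    rw [Finset.sum_congr rfl fun n _ => h1 _, ← hF, Finset.smul_sum]

/-- The channel that measures the effects `E₀`, `E₁` and prepares `T₀`, `T₁` accordingly. -/
theorem exists_measurePrepare {a b : ℕ} {E₀ E₁ : Op a} {T₀ T₁ : Op b} (hE₀ : E₀.PosSemidef)
    (hE₁ : E₁.PosSemidef) (hE : E₀ + E₁ = 1) (hT₀ : T₀ ∈ densityOps b) (hT₁ : T₁ ∈ densityOps b) :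
    ∃ M : Op a →ₗ[ℂ] Op b, IsQuantumChannel M ∧
      ∀ X, M X = (E₀ * X).trace • T₀ + (E₁ * X).trace • T₁ := by
  obtain ⟨K₀, h₀, h₀'⟩ := exists_kraus_trace_smul hE₀ hT₀.1
  obtain ⟨K₁, h₁, h₁'⟩ := exists_kraus_trace_smul hE₁ hT₁.1
  refine ⟨krausMap (Sum.elim K₀ K₁), krausMap_isQuantumChannel _ ?_, fun X => ?_⟩
  · simp [h₀', h₁', hT₀.2, hT₁.2, hE]
  · rw [← h₀, ← h₁]
    simp [krausMap_apply]

theorem conj_isQuantumChannel {a b : ℕ} {U : Matrix (Fin b) (Fin a) ℂ} (hU : Uᴴ * U = 1) :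
    ∃ M : Op a →ₗ[ℂ] Op b, IsQuantumChannel M ∧ ∀ X, M X = U * X * Uᴴ :=
  ⟨krausMap fun _ : Unit => U, krausMap_isQuantumChannel _ (by simpa using hU),
    fun X => by simp [krausMap_apply]⟩

theorem IsQuantumChannel.map_posSemidef {a b : ℕ} {N : Op a →ₗ[ℂ] Op b} (hN : IsQuantumChannel N)
    {X : Op a} (hX : X.PosSemidef) : (N X).PosSemidef := by
  obtain ⟨K, rfl⟩ := hN.exists_kraus
  exact Matrix.posSemidef_sum _ fun i _ => hX.mul_mul_conjTranspose_same _

theorem IsQuantumChannel.map_mem_densityOps {a b : ℕ} {N : Op a →ₗ[ℂ] Op b}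
    (hN : IsQuantumChannel N) {X : Op a} (hX : X ∈ densityOps a) : N X ∈ densityOps b :=
  ⟨hN.map_posSemidef hX.1, by rw [hN.tracePreserving, hX.2]⟩

/-! ### Domination of positive operators and supports -/

theorem trace_mul_nonneg {d : ℕ} {A B : Op d} (hA : A.PosSemidef) (hB : B.PosSemidef) :
    0 ≤ (A * B).trace := by
  obtain ⟨F, rfl⟩ := exists_eq_conjTranspose_mul_self hA
  rw [Matrix.mul_assoc, Matrix.trace_mul_comm]
  exact (hB.mul_mul_conjTranspose_same F).trace_nonneg

open scoped MatrixOrder Matrix.Norms.L2Operator in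
theorem exists_posSemidef_smul_one_sub {d : ℕ} {A : Op d} (hA : A.PosSemidef) :
    ∃ C : ℝ, 0 ≤ C ∧ (C • (1 : Op d) - A).PosSemidef := by
  refine ⟨‖A‖, norm_nonneg A, ?_⟩
  have h : A ≤ algebraMap ℝ (Op d) ‖A‖ := IsSelfAdjoint.le_algebraMap_norm_self hA.isHermitian
  rwa [Algebra.algebraMap_eq_smul_one, Matrix.le_iff] at h

/-- A positive semidefinite operator is dominated by a multiple of any other with smaller kernel. -/
theorem exists_posSemidef_smul_sub {d : ℕ} {A B : Op d} (hA : A.PosSemidef) (hB : B.PosSemidef)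
    (h : ∀ x, B *ᵥ x = 0 → A *ᵥ x = 0) : ∃ C : ℝ, 0 < C ∧ (C • B - A).PosSemidef := by
  obtain ⟨F, rfl⟩ := exists_eq_conjTranspose_mul_self hA
  obtain ⟨G, rfl⟩ := exists_eq_conjTranspose_mul_self hB
  have hker : LinearMap.ker G.mulVecLin ≤ LinearMap.ker F.mulVecLin := by
    intro x hx
    simp only [LinearMap.mem_ker, mulVecLin_apply] at hx ⊢
    rw [← conjTranspose_mul_self_mulVec_eq_zero]
    exact h x ((conjTranspose_mul_self_mulVec_eq_zero _ _).2 hx)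
  -- As ker G ⊆ ker F, the map G x ↦ F x is well defined on the range of G; extended to the whole
  -- space it gives F = P G, whence FᴴF ≤ ‖PᴴP‖ GᴴG.
  obtain ⟨L, hL⟩ := LinearMap.exists_extend (p := LinearMap.range G.mulVecLin)
    ((LinearMap.ker G.mulVecLin).liftQ F.mulVecLin hker ∘ₗ
      G.mulVecLin.quotKerEquivRange.symm.toLinearMap)
  have hF : F = LinearMap.toMatrix' L * G := by
    apply Matrix.toLin'.injective
    rw [Matrix.toLin'_mul, Matrix.toLin'_toMatrix']
    refine LinearMap.ext fun x => ?_
    have h1 := LinearMap.congr_fun hL ⟨G *ᵥ x, x, rfl⟩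
    have h2 : G.mulVecLin.quotKerEquivRange.symm ⟨G *ᵥ x, x, rfl⟩ =
        Submodule.Quotient.mk (p := LinearMap.ker G.mulVecLin) x := by
      rw [LinearEquiv.symm_apply_eq]
      rfl
    simp only [LinearMap.comp_apply, LinearEquiv.coe_coe, h2, Submodule.liftQ_apply,
      Submodule.subtype_apply] at h1
    exact h1.symm
  set P := LinearMap.toMatrix' L
  obtain ⟨C, hC, hCP⟩ := exists_posSemidef_smul_one_sub (posSemidef_conjTranspose_mul_self P)
  refine ⟨C + 1, by positivity, ?_⟩
  convert (hCP.conjTranspose_mul_mul_same G).add (posSemidef_conjTranspose_mul_self G) using 1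
  rw [hF]
  simp [Matrix.mul_sub, Matrix.sub_mul, add_smul, Matrix.mul_assoc]
  abel

theorem mulVec_eq_zero_of_smul_sub {d : ℕ} {A B : Op d} (hA : A.PosSemidef) {C : ℝ}
    (h : (C • B - A).PosSemidef) {x : Fin d → ℂ} (hx : B *ᵥ x = 0) : A *ᵥ x = 0 := by
  rw [← hA.dotProduct_mulVec_zero_iff]
  refine le_antisymm ?_ (hA.dotProduct_mulVec_nonneg x)
  have := h.dotProduct_mulVec_nonneg x
  simpa [Matrix.sub_mulVec, smul_mulVec, hx] using this

theorem supp_eq_supp_iff {d : ℕ} {A B : Op d} :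
    supp A = supp B ↔ ∀ x, A *ᵥ x = 0 ↔ B *ᵥ x = 0 := by
  have h1 : supp A = supp B ↔ LinearMap.ker (Matrix.toEuclideanLin A) =
      LinearMap.ker (Matrix.toEuclideanLin B) := by
    refine ⟨fun h => ?_, fun h => by rw [supp, supp, h]⟩
    rw [← Submodule.orthogonal_orthogonal (LinearMap.ker (Matrix.toEuclideanLin A)),
      ← Submodule.orthogonal_orthogonal (LinearMap.ker (Matrix.toEuclideanLin B))]
    exact congrArg _ h
  rw [h1, SetLike.ext_iff]
  constructor
  · intro h x
    simpa [Matrix.toLpLin_apply] using h (WithLp.toLp 2 x)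
  · intro h x
    simpa [Matrix.toLpLin_apply] using h x.ofLp

theorem add_mulVec_eq_zero_iff {d : ℕ} {A B : Op d} (hA : A.PosSemidef) (hB : B.PosSemidef)
    {s t : ℝ} (hs : 0 < s) (ht : 0 < t) (x : Fin d → ℂ) :
    (s • A + t • B) *ᵥ x = 0 ↔ A *ᵥ x = 0 ∧ B *ᵥ x = 0 := by
  constructor
  · intro h
    constructor
    · refine mulVec_eq_zero_of_smul_sub hA (C := s⁻¹) (B := s • A + t • B) ?_ h
      convert hB.smul (show 0 ≤ s⁻¹ * t by positivity) using 1
      rw [smul_add, smul_smul, smul_smul, inv_mul_cancel₀ hs.ne', one_smul, add_sub_cancel_left]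
    · refine mulVec_eq_zero_of_smul_sub hB (C := t⁻¹) (B := s • A + t • B) ?_ h
      convert hA.smul (show 0 ≤ t⁻¹ * s by positivity) using 1
      rw [smul_add, smul_smul, smul_smul, inv_mul_cancel₀ ht.ne', one_smul, add_sub_cancel_right]
  · rintro ⟨h1, h2⟩
    simp [Matrix.add_mulVec, smul_mulVec, h1, h2]

/-- Operators with equal supports have images with equal supports. -/
theorem IsQuantumChannel.supp_map_eq {a b : ℕ} {N : Op a →ₗ[ℂ] Op b} (hN : IsQuantumChannel N)
    {ρ γ : Op a} (hρ : ρ.PosSemidef) (hγ : γ.PosSemidef) (h : supp ρ = supp γ) :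
    supp (N ρ) = supp (N γ) := by
  have key : ∀ {ρ γ : Op a}, ρ.PosSemidef → γ.PosSemidef → supp ρ = supp γ →
      ∀ x, N γ *ᵥ x = 0 → N ρ *ᵥ x = 0 := by
    intro ρ γ hρ hγ h x hx
    obtain ⟨C, -, hC⟩ := exists_posSemidef_smul_sub hρ hγ fun x => (supp_eq_supp_iff.1 h x).2
    have h1 := hN.map_posSemidef hC
    have h2 : N (C • γ - ρ) = C • N γ - N ρ := by
      rw [map_sub, LinearMap.map_smul_of_tower]
    exact mulVec_eq_zero_of_smul_sub (hN.map_posSemidef hρ) (h2 ▸ h1) hx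
  exact supp_eq_supp_iff.2 fun x => ⟨key hγ hρ h.symm x, key hρ hγ h x⟩

open Set Filter

variable {f : ℝ → ℝ} {D : (d : ℕ) → Op d → Op d → EReal}

/-! ### The generating function near 1 and binary divergences -/

/-- The case of 1 × 1 matrices. Only this scalar convexity is extracted from operator convexity. -/
theorem OperatorConvex.convexOn (hf : OperatorConvex f) : ConvexOn ℝ (Ioi 0) f := by
  refine convexOn_iff_forall_pos.2 ⟨convex_Ioi 0, fun x hx y hy s t hs ht hst => ?_⟩
  have hpd : ∀ r : ℝ, 0 < r → (algebraMap ℝ (Op 1) r).PosDef := fun r hr => by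
    rw [Algebra.algebraMap_eq_smul_one]
    exact PosDef.one.smul hr
  have h := hf 1 _ _ (hpd x hx) (hpd y hy) s ⟨hs, by linarith⟩
  have hlin : ∀ u v : ℝ, s • algebraMap ℝ (Op 1) u + (1 - s) • algebraMap ℝ (Op 1) v =
      algebraMap ℝ (Op 1) (s • u + t • v) := fun u v => by
    rw [← eq_sub_of_add_eq' hst]
    simp [Algebra.algebraMap_eq_smul_one, add_smul, mul_smul]
  rw [cfc_algebraMap x f, cfc_algebraMap y f, hlin, hlin, cfc_algebraMap, ← map_sub] at h
  have h3 := h.diag_nonneg (i := 0)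
  rw [Matrix.algebraMap_matrix_apply, if_pos rfl] at h3
  simpa [Complex.le_def] using h3


theorem ClassF.hasDerivAt_deriv (hf : ClassF f) :
    HasDerivAt (deriv f) (deriv (deriv f) 1) 1 :=
  (differentiableAt_of_deriv_ne_zero hf.deriv_two_pos.ne').hasDerivAt

/-- Not automatic, since `deriv` defaults to 0. If `f` were not differentiable at 1, then `deriv f 1
= 0`. As `deriv f` has nonzero derivative at 1, it is nonzero at nearby points, so `f` is
differentiable there. Continuity of `deriv f` at 1 then gives equal one-sided derivatives. -/
theorem ClassF.hasDerivAt_one (hf : ClassF f) : HasDerivAt f (deriv f 1) 1 := by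
  by_contra hcon
  have hnd : ¬ DifferentiableAt ℝ f 1 := fun h => hcon h.hasDerivAt
  have h0 : deriv f 1 = 0 := deriv_zero_of_not_differentiableAt hnd
  have hne : ∀ᶠ y in 𝓝[≠] 1, DifferentiableAt ℝ f y :=
    (hf.hasDerivAt_deriv.eventually_ne (c := 0) hf.deriv_two_pos.ne').mono
      fun y hy => differentiableAt_of_deriv_ne_zero hy
  have hcont : ContinuousAt f 1 :=
    hf.operatorConvex.convexOn.continuousOn isOpen_Ioi |>.continuousAt (Ioi_mem_nhds one_pos)
  have hlim := hf.hasDerivAt_deriv.continuousAt.tendsto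
  refine hcon ?_
  have hR : HasDerivWithinAt f (deriv f 1) (Ici 1) 1 :=
    hasDerivWithinAt_Ici_of_tendsto_deriv (s := {y | DifferentiableAt ℝ f y})
      (fun y hy => hy.differentiableWithinAt) hcont.continuousWithinAt
      (nhdsGT_le_nhdsNE 1 hne) (hlim.mono_left nhdsWithin_le_nhds)
  have hL : HasDerivWithinAt f (deriv f 1) (Iic 1) 1 :=
    hasDerivWithinAt_Iic_of_tendsto_deriv (s := {y | DifferentiableAt ℝ f y})
      (fun y hy => hy.differentiableWithinAt) hcont.continuousWithinAt
      (nhdsLT_le_nhdsNE 1 hne) (hlim.mono_left nhdsWithin_le_nhds)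
  simpa using (hL.union hR)

/-- The generating function with its tangent line at `1` subtracted. -/
noncomputable def tangentGap (f : ℝ → ℝ) (x : ℝ) : ℝ := f x - deriv f 1 * (x - 1)

theorem ClassF.tangentGap_convexOn (hf : ClassF f) : ConvexOn ℝ (Ioi 0) (tangentGap f) := by
  refine hf.operatorConvex.convexOn.sub ⟨convex_Ioi 0, fun x _ y _ s t _ _ hst => ?_⟩
  simp only [smul_eq_mul]
  rw [eq_sub_of_add_eq' hst]
  apply le_of_eq
  ring

theorem ClassF.tangentGap_one (hf : ClassF f) : tangentGap f 1 = 0 := by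
  simp [tangentGap, hf.map_one]

theorem ClassF.hasDerivAt_tangentGap (hf : ClassF f) : HasDerivAt (tangentGap f) 0 1 := by
  have h := hf.hasDerivAt_one.sub (((hasDerivAt_id 1).sub_const 1).const_mul (deriv f 1))
  rwa [mul_one, sub_self] at h

theorem ClassF.tangentGap_nonneg (hf : ClassF f) {x : ℝ} (hx : 0 < x) : 0 ≤ tangentGap f x := by
  have h1 : (1 : ℝ) ∈ Ioi (0 : ℝ) := mem_Ioi.2 one_pos
  rcases lt_trichotomy x 1 with h | rfl | h
  · have := hf.tangentGap_convexOn.slope_le_of_hasDerivAt (mem_Ioi.2 hx) h1 h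
      hf.hasDerivAt_tangentGap
    rw [slope_def_field, hf.tangentGap_one, div_le_iff₀ (sub_pos.2 h)] at this
    linarith
  · exact hf.tangentGap_one.ge
  · have := hf.tangentGap_convexOn.le_slope_of_hasDerivAt h1 (mem_Ioi.2 hx) h
      hf.hasDerivAt_tangentGap
    rw [slope_def_field, hf.tangentGap_one, le_div_iff₀ (sub_pos.2 h)] at this
    linarith

/-- A zero at x ≠ 1 would make the convex gap vanish between 1 and x. Then `deriv f` would be
constant on one side of 1, against f''(1) ≠ 0. -/
theorem ClassF.tangentGap_pos (hf : ClassF f) {x : ℝ} (hx : 0 < x) (hx1 : x ≠ 1) :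
    0 < tangentGap f x := by
  refine (hf.tangentGap_nonneg hx).lt_of_ne' fun h0 => ?_
  have hseg : ∀ y ∈ segment ℝ 1 x, f y = deriv f 1 * (y - 1) := by
    intro y hy
    have h1 := hf.tangentGap_convexOn.le_on_segment (mem_Ioi.2 one_pos) (mem_Ioi.2 hx) hy
    rw [h0, hf.tangentGap_one, max_self] at h1
    have hy0 : 0 < y := (convex_Ioi (0 : ℝ)).segment_subset (mem_Ioi.2 one_pos) (mem_Ioi.2 hx) hy
    have h2 := hf.tangentGap_nonneg hy0
    unfold tangentGap at h1 h2
    linarith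
  have hd : ∀ s : Set ℝ, IsOpen s → s ⊆ segment ℝ 1 x → ∀ y ∈ s, deriv f y = deriv f 1 := by
    intro s hs hsub y hy
    have : f =ᶠ[𝓝 y] fun y => deriv f 1 * (y - 1) :=
      Filter.mem_of_superset (hs.mem_nhds hy) fun z hz => hseg z (hsub hz)
    rw [this.deriv_eq]
    simp
  have hne := hf.hasDerivAt_deriv.eventually_ne (c := deriv f 1) hf.deriv_two_pos.ne'
  rcases hx1.lt_or_gt with hlt | hgt
  · have h1 : ∀ᶠ y in 𝓝[<] (1 : ℝ), y ∈ Ioo x 1 := Ioo_mem_nhdsLT hlt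
    obtain ⟨y, hy1, hy2⟩ := (h1.and (nhdsLT_le_nhdsNE 1 hne)).exists
    refine hy2 (hd _ isOpen_Ioo ?_ y hy1)
    rw [segment_symm, segment_eq_Icc hlt.le]
    exact Ioo_subset_Icc_self
  · have h1 : ∀ᶠ y in 𝓝[>] (1 : ℝ), y ∈ Ioo 1 x := Ioo_mem_nhdsGT hgt
    obtain ⟨y, hy1, hy2⟩ := (h1.and (nhdsGT_le_nhdsNE 1 hne)).exists
    refine hy2 (hd _ isOpen_Ioo ?_ y hy1)
    rw [segment_eq_Icc hgt.le]
    exact Ioo_subset_Icc_self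

/-- The classical divergence of the two-point distributions `(p, 1 - p)` and `(q, 1 - q)`. -/
noncomputable def binDiv (f : ℝ → ℝ) (p q : ℝ) : ℝ :=
  q * f (p / q) + (1 - q) * f ((1 - p) / (1 - q))

theorem classicalFDiv_two (f : ℝ → ℝ) (p q : ℝ) :
    classicalFDiv f ![p, 1 - p] ![q, 1 - q] = binDiv f p q := by
  simp [classicalFDiv, binDiv]

/-- The linear corrections cancel because both distributions have total mass 1. -/
theorem binDiv_eq_tangentGap {p q : ℝ} (hq : q ∈ Ioo (0 : ℝ) 1) :
    binDiv f p q = q * tangentGap f (p / q) + (1 - q) * tangentGap f ((1 - p) / (1 - q)) := by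
  have h1 : q ≠ 0 := hq.1.ne'
  have h2 : 1 - q ≠ 0 := (sub_pos.2 hq.2).ne'
  unfold binDiv tangentGap
  field_simp
  ring

theorem ClassF.binDiv_pos (hf : ClassF f) {p q : ℝ} (hp : p ∈ Ioo (0 : ℝ) 1)
    (hq : q ∈ Ioo (0 : ℝ) 1) (h : p ≠ q) : 0 < binDiv f p q := by
  rw [binDiv_eq_tangentGap hq]
  have h1 : 0 < tangentGap f (p / q) := hf.tangentGap_pos (div_pos hp.1 hq.1) (by
    rwa [ne_eq, div_eq_one_iff_eq hq.1.ne'])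
  have h2 : 0 ≤ tangentGap f ((1 - p) / (1 - q)) :=
    hf.tangentGap_nonneg (div_pos (sub_pos.2 hp.2) (sub_pos.2 hq.2))
  exact add_pos_of_pos_of_nonneg (mul_pos hq.1 h1) (mul_nonneg (sub_pos.2 hq.2).le h2)

/-- Near the boundary the divergence of `2 ε` from `ε` is at least linear in `ε`. -/
theorem ClassF.le_binDiv (hf : ClassF f) {ε : ℝ} (h0 : 0 < ε) (h1 : 2 * ε < 1) :
    ε * tangentGap f 2 ≤ binDiv f (2 * ε) ε := by
  -- The first likelihood ratio is 2ε/ε = 2 for every ε, so its term alone is linear in ε; the other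
  -- term is nonnegative.
  rw [binDiv_eq_tangentGap ⟨h0, by linarith⟩, mul_div_cancel_right₀ _ h0.ne']
  have h2 : 0 ≤ tangentGap f ((1 - 2 * ε) / (1 - ε)) :=
    hf.tangentGap_nonneg (div_pos (by linarith) (by linarith))
  have := mul_nonneg (show 0 ≤ 1 - ε by linarith) h2
  linarith

/-- Since f(1) = 0, the derivative is f'(1)(P' - Q') from the first outcome and its negative from
the second. -/
theorem ClassF.hasDerivAt_binDiv (hf : ClassF f) {P Q : ℝ → ℝ} {P' Q' : ℝ}
    (hP : HasDerivAt P P' 0) (hQ : HasDerivAt Q Q' 0) (h0 : P 0 = Q 0) (hQ0 : Q 0 ∈ Ioo (0 : ℝ) 1) :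
    HasDerivAt (fun ε => binDiv f (P ε) (Q ε)) 0 0 := by
  have h1 : Q 0 ≠ 0 := hQ0.1.ne'
  have h2 : 1 - Q 0 ≠ 0 := (sub_pos.2 hQ0.2).ne'
  have hu := hP.div hQ h1
  have hv := (hP.const_sub 1).div (hQ.const_sub 1) h2
  have hfu : HasDerivAt (fun ε => f (P ε / Q ε)) _ 0 :=
    hf.hasDerivAt_one.comp_of_eq (0 : ℝ) hu (by simp [h0, h1])
  have hfv : HasDerivAt (fun ε => f ((1 - P ε) / (1 - Q ε))) _ 0 :=
    hf.hasDerivAt_one.comp_of_eq (0 : ℝ) hv (by simp [h0, h2])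
  refine ((hQ.mul hfu).add ((hQ.const_sub 1).mul hfv)).congr_deriv ?_
  simp only [h0, div_self h1, div_self h2, hf.map_one]
  field_simp
  ring

/-- In the interior the divergence vanishes to higher than first order. -/
theorem ClassF.binDiv_isLittleO (hf : ClassF f) {s : ℝ} (hs : 0 < s) :
    (fun ε : ℝ => binDiv f ((2 * ε + s) / (1 + s)) ((ε + s) / (1 + s))) =o[𝓝 0] fun ε => ε := by
  have h1 : s / (1 + s) ∈ Ioo (0 : ℝ) 1 :=
    ⟨by positivity, (div_lt_one (by positivity)).2 (by linarith)⟩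
  have h := hf.hasDerivAt_binDiv
    (((((hasDerivAt_id (0 : ℝ)).const_mul 2).add_const s)).div_const (1 + s))
    ((((hasDerivAt_id (0 : ℝ)).add_const s)).div_const (1 + s)) (by simp) (by simpa using h1)
  have h2 : binDiv f (s / (1 + s)) (s / (1 + s)) = 0 := by
    simp [binDiv, div_self h1.1.ne', div_self (sub_pos.2 h1.2).ne', hf.map_one]
  simpa [h2] using h.isLittleO

/-! ### Segments of states; binary bounds, positivity and finiteness of the divergence -/

theorem smul_add_smul_mem_densityOps {d : ℕ} {A B : Op d} (hA : A ∈ densityOps d)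
    (hB : B ∈ densityOps d) {s t : ℝ} (hs : 0 ≤ s) (ht : 0 ≤ t) (hst : s + t = 1) :
    s • A + t • B ∈ densityOps d := by
  refine ⟨(hA.1.smul hs).add (hB.1.smul ht), ?_⟩
  rw [trace_add, trace_smul, trace_smul, hA.2, hB.2, ← add_smul, hst, one_smul]

theorem supp_smul_add_smul {d : ℕ} {A B : Op d} (hA : A.PosSemidef) (hB : B.PosSemidef)
    {s t s' t' : ℝ} (hs : 0 < s) (ht : 0 < t) (hs' : 0 < s') (ht' : 0 < t') :
    supp (s • A + t • B) = supp (s' • A + t' • B) :=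
  supp_eq_supp_iff.2 fun x => by
    rw [add_mulVec_eq_zero_iff hA hB hs ht, add_mulVec_eq_zero_iff hA hB hs' ht']

/-- Moving from `A` away from `B` one stays within the states for a while if `B` is dominated
by `A`. -/
theorem extrapolate_mem_densityOps {d : ℕ} {A B : Op d} (hA : A ∈ densityOps d)
    (hB : B ∈ densityOps d) {C : ℝ} (hC : 0 < C) (h : (C • A - B).PosSemidef) :
    (1 + C⁻¹) • A - C⁻¹ • B ∈ densityOps d := by
  refine ⟨?_, ?_⟩
  · convert (hA.1.smul (inv_pos.2 hC).le).add (h.smul (inv_pos.2 hC).le) using 1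
    rw [smul_sub, smul_smul, inv_mul_cancel₀ hC.ne']
    module
  · rw [trace_sub, trace_smul, trace_smul, hA.2, hB.2, add_smul, one_smul, add_sub_cancel_right]


theorem diagonal_mem_densityOps {p : ℝ} (hp : p ∈ Ioo (0 : ℝ) 1) :
    diagonal ![(p : ℂ), 1 - p] ∈ densityOps 2 := by
  refine ⟨PosSemidef.diagonal fun i => ?_, by simp⟩
  fin_cases i
  · simpa using hp.1.le
  · have h := hp.2.le
    simpa [Complex.le_def] using h

theorem supp_diagonal_eq {p q : ℝ} (hp : p ∈ Ioo (0 : ℝ) 1) (hq : q ∈ Ioo (0 : ℝ) 1) :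
    supp (diagonal ![(p : ℂ), 1 - p]) = supp (diagonal ![(q : ℂ), 1 - q]) := by
  have key : ∀ {p : ℝ}, p ∈ Ioo (0 : ℝ) 1 → ∀ x : Fin 2 → ℂ,
      diagonal ![(p : ℂ), 1 - p] *ᵥ x = 0 ↔ x = 0 := by
    intro p hp x
    have h1 : (p : ℂ) ≠ 0 := by exact_mod_cast hp.1.ne'
    have h2 : (1 - p : ℂ) ≠ 0 := by exact_mod_cast (sub_pos.2 hp.2).ne'
    simp [funext_iff, Fin.forall_fin_two, h1, h2]
  exact supp_eq_supp_iff.2 fun x => by rw [key hp, key hq]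

theorem IsMonotoneFDivergence.diagonal_two (hD : IsMonotoneFDivergence f D) {p q : ℝ}
    (hp : p ∈ Ioo (0 : ℝ) 1) (hq : q ∈ Ioo (0 : ℝ) 1) :
    D 2 (diagonal ![(p : ℂ), 1 - p]) (diagonal ![(q : ℂ), 1 - q]) = (binDiv f p q : EReal) := by
  have hs : ∀ {p : ℝ}, p ∈ Ioo (0 : ℝ) 1 → ![p, 1 - p] ∈ stdSimplex ℝ (Fin 2) := fun hp =>
    ⟨by simpa [Fin.forall_fin_two] using ⟨hp.1.le, hp.2.le⟩, by simp⟩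
  have hd : ∀ p : ℝ, (fun y => ((![p, 1 - p] y : ℝ) : ℂ)) = ![(p : ℂ), 1 - p] := fun p => by
    ext y
    fin_cases y <;> simp
  have h := hD.classical 2 ![p, 1 - p] ![q, 1 - q] (hs hp) (hs hq)
    (by simp [Fin.forall_fin_two, hp.1.ne', hq.1.ne', (sub_pos.2 hp.2).ne', (sub_pos.2 hq.2).ne'])
    1 (one_mem _)
  simpa only [hd, one_mul, conjTranspose_one, mul_one, classicalFDiv_two] using h

/-- Lower bounds on the divergence by two-outcome measurements. -/
theorem IsMonotoneFDivergence.binDiv_le (hD : IsMonotoneFDivergence f D) {d : ℕ} {ρ γ E : Op d}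
    (hρ : ρ ∈ densityOps d) (hγ : γ ∈ densityOps d) (h : supp ρ = supp γ) (hE : E.PosSemidef)
    (hE' : (1 - E).PosSemidef) {p q : ℝ} (hp : p ∈ Ioo (0 : ℝ) 1) (hq : q ∈ Ioo (0 : ℝ) 1)
    (hpE : (E * ρ).trace = p) (hqE : (E * γ).trace = q) : (binDiv f p q : EReal) ≤ D d ρ γ := by
  have h0 : (diagonal ![(1 : ℂ), 0]) ∈ densityOps 2 :=
    ⟨PosSemidef.diagonal fun i => by fin_cases i <;> simp, by simp⟩
  have h1 : (diagonal ![(0 : ℂ), 1]) ∈ densityOps 2 :=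
    ⟨PosSemidef.diagonal fun i => by fin_cases i <;> simp, by simp⟩
  obtain ⟨M, hM, hMX⟩ := exists_measurePrepare hE hE' (add_sub_cancel _ _) h0 h1
  have key : ∀ {σ : Op d} {r : ℝ}, σ ∈ densityOps d → (E * σ).trace = r →
      M σ = diagonal ![(r : ℂ), 1 - r] := by
    intro σ r hσ hr
    rw [hMX, hr, Matrix.sub_mul, Matrix.one_mul, trace_sub, hσ.2, hr, ← diagonal_smul,
      ← diagonal_smul, diagonal_add]
    congr 1
    ext i
    fin_cases i <;> simp
  have := hD.monotone d 2 M hM ρ hρ γ hγ h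
  rwa [key hρ hpE, key hγ hqE, hD.diagonal_two hp hq] at this

/-- Upper bounds on the divergence by preparing from two-point distributions. -/
theorem IsMonotoneFDivergence.le_binDiv (hD : IsMonotoneFDivergence f D) {d : ℕ} {S T : Op d}
    (hS : S ∈ densityOps d) (hT : T ∈ densityOps d) {p q : ℝ} (hp : p ∈ Ioo (0 : ℝ) 1)
    (hq : q ∈ Ioo (0 : ℝ) 1) :
    D d (p • S + (1 - p) • T) (q • S + (1 - q) • T) ≤ (binDiv f p q : EReal) := by
  have h0 : (diagonal ![(1 : ℂ), 0]).PosSemidef :=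
    PosSemidef.diagonal fun i => by fin_cases i <;> simp
  have h1 : (diagonal ![(0 : ℂ), 1]).PosSemidef :=
    PosSemidef.diagonal fun i => by fin_cases i <;> simp
  obtain ⟨M, hM, hMX⟩ := exists_measurePrepare h0 h1 (by
    rw [diagonal_add, ← diagonal_one]; congr 1; ext i; fin_cases i <;> simp) hS hT
  have key : ∀ r : ℝ, M (diagonal ![(r : ℂ), 1 - r]) = r • S + (1 - r) • T := by
    intro r
    rw [hMX, diagonal_mul_diagonal, diagonal_mul_diagonal, trace_diagonal, trace_diagonal]
    simp only [Fin.sum_univ_two, cons_val_zero, cons_val_one, one_mul, zero_mul, add_zero, zero_add]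
    rw [← Complex.ofReal_one, ← Complex.ofReal_sub, Complex.coe_smul, Complex.coe_smul]
  have := hD.monotone 2 d M hM _ (diagonal_mem_densityOps hp) _ (diagonal_mem_densityOps hq)
    (supp_diagonal_eq hp hq)
  rwa [key, key, hD.diagonal_two hp hq] at this

theorem IsMonotoneFDivergence.nonneg (hD : IsMonotoneFDivergence f D) (hf : ClassF f) {d : ℕ}
    {ρ γ : Op d} (hρ : ρ ∈ densityOps d) (hγ : γ ∈ densityOps d) (h : supp ρ = supp γ) :
    0 ≤ D d ρ γ := by
  have h2 : (1 / 2 : ℝ) ∈ Ioo (0 : ℝ) 1 := by norm_num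
  have h3 : (1 - (1 / 2 : ℝ) • (1 : Op d)).PosSemidef := by
    convert (PosSemidef.one (n := Fin d) (R := ℂ)).smul h2.1.le using 1
    module
  -- The uninformative effect 1/2 gives both states the same outcome distribution.
  have := hD.binDiv_le hρ hγ h (PosSemidef.one.smul h2.1.le) h3 h2 h2
    (by simp [trace_smul, hρ.2]) (by simp [trace_smul, hγ.2])
  simpa [binDiv, hf.map_one, show (1 - 2⁻¹ : ℝ) = 2⁻¹ by norm_num] using this

/-- Measure an affine rescaling of ρ - γ: the two outcome probabilities differ by a positive
multiple of tr (ρ - γ)². -/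
theorem IsMonotoneFDivergence.pos (hD : IsMonotoneFDivergence f D) (hf : ClassF f) {d : ℕ}
    {ρ γ : Op d} (hρ : ρ ∈ densityOps d) (hγ : γ ∈ densityOps d) (h : supp ρ = supp γ)
    (hne : ρ ≠ γ) : 0 < D d ρ γ := by
  obtain ⟨C, hC0, hC⟩ := exists_posSemidef_smul_one_sub hγ.1
  -- The extra 1 here, and the one in `c + 1` below, keep both outcome probabilities strictly inside
  -- (0, 1).
  have hE' : (ρ - γ + (C + 1) • (1 : Op d)).PosSemidef := by
    convert (hρ.1.add hC).add PosSemidef.one using 1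
    rw [add_smul, one_smul]
    abel
  set E' := ρ - γ + (C + 1) • (1 : Op d) with hE'_def
  obtain ⟨c, hc0, hc⟩ := exists_posSemidef_smul_one_sub hE'
  have hc1 : 0 < c + 1 := by positivity
  have hE : ((c + 1)⁻¹ • E').PosSemidef := hE'.smul (inv_pos.2 hc1).le
  have hE1 : (1 - (c + 1)⁻¹ • E').PosSemidef := by
    convert (hc.add PosSemidef.one).smul (inv_pos.2 hc1).le using 1
    match_scalars <;> field_simp
    ring
  have htr : ∀ {σ : Op d}, σ ∈ densityOps d →
      ∃ r ∈ Ioo (0 : ℝ) 1, ((c + 1)⁻¹ • E' * σ).trace = r := by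
    intro σ hσ
    have h1 := trace_mul_nonneg (hρ.1.add hC) hσ.1
    have h2 := trace_mul_nonneg hc hσ.1
    have h3 : ρ + (C • (1 : Op d) - γ) = E' - 1 := by
      rw [hE'_def]
      module
    rw [h3, Matrix.sub_mul, Matrix.one_mul, trace_sub, hσ.2] at h1
    rw [Matrix.sub_mul, smul_mul, Matrix.one_mul, trace_sub, trace_smul, hσ.2] at h2
    rw [smul_mul, trace_smul]
    generalize (E' * σ).trace = e at h1 h2
    simp only [Complex.le_def, Complex.zero_re, Complex.sub_re, Complex.one_re, Complex.zero_im,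
      Complex.sub_im, Complex.one_im, sub_zero, Complex.real_smul, mul_one, Complex.ofReal_re]
      at h1 h2
    refine ⟨(c + 1)⁻¹ * e.re, ⟨mul_pos (inv_pos.2 hc1) (by linarith), ?_⟩, ?_⟩
    · rw [inv_mul_lt_iff₀ hc1]
      linarith
    · apply Complex.ext <;> simp [← h1.2]
  obtain ⟨p, hp, hpE⟩ := htr hρ
  obtain ⟨q, hq, hqE⟩ := htr hγ
  have hpq : p ≠ q := by
    rintro rfl
    have h0 : ((c + 1)⁻¹ • E' * (ρ - γ)).trace = 0 := by
      rw [Matrix.mul_sub, trace_sub, hpE, hqE, sub_self]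
    have hH : (ρ - γ).IsHermitian := hρ.1.isHermitian.sub hγ.1.isHermitian
    have h1 : ((ρ - γ)ᴴ * (ρ - γ)).trace = 0 := by
      rw [smul_mul, trace_smul, smul_eq_zero_iff_right (inv_pos.2 hc1).ne', hE'_def, Matrix.add_mul,
        smul_mul, Matrix.one_mul, trace_add, trace_smul, trace_sub, hρ.2, hγ.2, sub_self,
        smul_zero, add_zero] at h0
      rwa [hH.eq]
    exact hne (sub_eq_zero.1 (trace_conjTranspose_mul_self_eq_zero_iff.1 h1))
  exact lt_of_lt_of_le (by exact_mod_cast hf.binDiv_pos hp hq hpq)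
    (hD.binDiv_le hρ hγ h hE hE1 hp hq hpE hqE)

/-- With equal supports, the segment from ρ to γ extends beyond both ends within the states, so both
are mixtures of the new endpoints with weights in (0, 1), and a real-valued binary divergence bounds
`D`. -/
theorem IsMonotoneFDivergence.lt_top (hD : IsMonotoneFDivergence f D) {d : ℕ}
    {ρ γ : Op d} (hρ : ρ ∈ densityOps d) (hγ : γ ∈ densityOps d) (h : supp ρ = supp γ) :
    D d ρ γ < ⊤ := by
  rw [supp_eq_supp_iff] at h
  obtain ⟨C, hC0, hC⟩ := exists_posSemidef_smul_sub hγ.1 hρ.1 fun x => (h x).1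
  obtain ⟨c, hc0, hc⟩ := exists_posSemidef_smul_sub hρ.1 hγ.1 fun x => (h x).2
  have hS := extrapolate_mem_densityOps hρ hγ hC0 hC
  have hT := extrapolate_mem_densityOps hγ hρ hc0 hc
  have hs := inv_pos.2 hC0
  have ht := inv_pos.2 hc0
  generalize C⁻¹ = s at *
  generalize c⁻¹ = t at *
  have hL : 0 < 1 + s + t := by positivity
  -- Put ρ at 0 and γ at 1 on the line: the endpoints are at -s and 1 + t, and these are the
  -- barycentric weights of the former.
  have hp : (1 + t) / (1 + s + t) ∈ Ioo (0 : ℝ) 1 :=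
    ⟨by positivity, (div_lt_one hL).2 (by linarith)⟩
  have hq : t / (1 + s + t) ∈ Ioo (0 : ℝ) 1 :=
    ⟨by positivity, (div_lt_one hL).2 (by linarith)⟩
  have := hD.le_binDiv hS hT hp hq
  have h1 : ((1 + t) / (1 + s + t)) • ((1 + s) • ρ - s • γ) +
      (1 - (1 + t) / (1 + s + t)) • ((1 + t) • γ - t • ρ) = ρ := by
    match_scalars <;> (field_simp; ring)
  have h2 : (t / (1 + s + t)) • ((1 + s) • ρ - s • γ) +
      (1 - t / (1 + s + t)) • ((1 + t) • γ - t • ρ) = γ := by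
    match_scalars <;> (field_simp; ring)
  rw [h1, h2] at this
  exact this.trans_lt (EReal.coe_lt_top _)

/-! ### The vanishing criterion -/

/-- The expansion coefficient vanishes if `E` separates two states `α`, `β` perfectly, but `N β`
is dominated by `N α`. -/
theorem IsMonotoneFDivergence.expansionCoeff_nonpos (hD : IsMonotoneFDivergence f D)
    (hf : ClassF f) {a b : ℕ} {N : Op a →ₗ[ℂ] Op b} (hN : IsQuantumChannel N) {α β E : Op a}
    (hα : α ∈ densityOps a) (hβ : β ∈ densityOps a) (hE : E.PosSemidef) (hE' : (1 - E).PosSemidef)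
    (hEα : (E * α).trace = 0) (hEβ : (E * β).trace = 1) {C : ℝ} (hC : 0 < C)
    (h : (C • N α - N β).PosSemidef) : expansionCoeff D N ≤ 0 := by
  have hg : 0 < tangentGap f 2 := hf.tangentGap_pos two_pos (by norm_num)
  have hNα := hN.map_mem_densityOps hα
  have hNβ := hN.map_mem_densityOps hβ
  have hT := extrapolate_mem_densityOps hNα hNβ hC h
  have hs : 0 < C⁻¹ := inv_pos.2 hC
  generalize C⁻¹ = s at hT hs
  refine EReal.le_of_forall_lt_iff_le.1 fun δ hδ => ?_
  have hδ : 0 < δ := by exact_mod_cast hδ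
  have hev : ∀ᶠ ε : ℝ in 𝓝[>] 0, binDiv f ((2 * ε + s) / (1 + s)) ((ε + s) / (1 + s)) ≤
      δ * tangentGap f 2 * ‖ε‖ :=
    (((hf.binDiv_isLittleO hs).def (mul_pos hδ hg)).filter_mono nhdsWithin_le_nhds).mono
      fun ε hε => (le_abs_self _).trans hε
  have hev' : ∀ᶠ ε : ℝ in 𝓝[>] 0, ε ∈ Ioo (0 : ℝ) (1 / 2) := Ioo_mem_nhdsGT (by norm_num)
  obtain ⟨ε, hε, hε0, hε1⟩ := (hev.and hev').exists
  rw [Real.norm_of_nonneg hε0.le] at hε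
  have hmem : ∀ t ∈ Ioo (0 : ℝ) 1, (1 - t) • α + t • β ∈ densityOps a := fun t ht =>
    smul_add_smul_mem_densityOps hα hβ (sub_pos.2 ht.2).le ht.1.le (by ring)
  have htr : ∀ t : ℝ, (E * ((1 - t) • α + t • β)).trace = t := fun t => by
    rw [Matrix.mul_add, Matrix.mul_smul, Matrix.mul_smul, trace_add, trace_smul, trace_smul, hEα, hEβ]
    simp
  -- Rewritten from the extrapolated endpoint (1 + s) N α - s N β, the weight t of N β becomes (t +
  -- s)/(1 + s), which stays away from 0 as t → 0.
  have hNt : ∀ t : ℝ, N ((1 - t) • α + t • β) = ((t + s) / (1 + s)) • N β +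
      (1 - (t + s) / (1 + s)) • ((1 + s) • N α - s • N β) := fun t => by
    rw [map_add, LinearMap.map_smul_of_tower, LinearMap.map_smul_of_tower]
    match_scalars <;> (field_simp; ring)
  have hIoo : ∀ t ∈ Ioo (0 : ℝ) 1, (t + s) / (1 + s) ∈ Ioo (0 : ℝ) 1 := fun t ht =>
    ⟨div_pos (by linarith [ht.1]) (by linarith), (div_lt_one (by linarith)).2 (by linarith [ht.2])⟩
  have h1 : ε ∈ Ioo (0 : ℝ) 1 := ⟨hε0, by linarith⟩
  have h2 : 2 * ε ∈ Ioo (0 : ℝ) 1 := ⟨by linarith, by linarith⟩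
  have hsupp := supp_smul_add_smul hα.1 hβ.1 (sub_pos.2 h2.2) h2.1 (sub_pos.2 h1.2) h1.1
  have hne : (1 - 2 * ε) • α + (2 * ε) • β ≠ (1 - ε) • α + ε • β := fun heq => by
    have h3 := htr (2 * ε)
    rw [heq, htr] at h3
    have h4 : ε = 2 * ε := by exact_mod_cast h3
    linarith
  have hin : ((ε * tangentGap f 2 : ℝ) : EReal) ≤
      D a ((1 - 2 * ε) • α + (2 * ε) • β) ((1 - ε) • α + ε • β) :=
    (EReal.coe_le_coe_iff.2 (hf.le_binDiv hε0 h2.2)).trans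
      (hD.binDiv_le (hmem _ h2) (hmem _ h1) hsupp hE hE' h2 h1 (htr _) (htr _))
  have hout := hD.le_binDiv hNβ hT (hIoo _ h2) (hIoo _ h1)
  rw [← hNt, ← hNt] at hout
  unfold expansionCoeff
  refine le_trans (sInf_le ⟨_, hmem _ h2, _, hmem _ h1, hne, hsupp, rfl⟩) ?_
  rw [EReal.div_le_iff_le_mul (hD.pos hf (hmem _ h2) (hmem _ h1) hsupp hne)
    (hD.lt_top (hmem _ h2) (hmem _ h1) hsupp).ne, mul_comm (D _ _ _)]
  calc _ ≤ _ := hout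
    _ ≤ ((δ * (ε * tangentGap f 2) : ℝ) : EReal) := by
      rw [EReal.coe_le_coe_iff]
      linarith
    _ ≤ _ := by
      rw [EReal.coe_mul]
      exact mul_le_mul_of_nonneg_left hin (by exact_mod_cast hδ.le)

/-! ### Dimension count for Kraus images of orthonormal families -/

theorem sum_mulVec_eq_zero_iff {d : ℕ} {ι : Type*} {s : Finset ι} {A : ι → Op d}
    (hA : ∀ i ∈ s, (A i).PosSemidef) (x : Fin d → ℂ) :
    (∑ i ∈ s, A i) *ᵥ x = 0 ↔ ∀ i ∈ s, A i *ᵥ x = 0 := by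
  rw [← (Matrix.posSemidef_sum s hA).dotProduct_mulVec_zero_iff, Matrix.sum_mulVec,
    dotProduct_sum, Finset.sum_eq_zero_iff_of_nonneg fun i hi => (hA i hi).dotProduct_mulVec_nonneg x]
  exact forall₂_congr fun i hi => (hA i hi).dotProduct_mulVec_zero_iff x

theorem krausMap_vecMulVec {ι : Type*} [Fintype ι] {a b : ℕ} (K : ι → Matrix (Fin b) (Fin a) ℂ)
    (v : Fin a → ℂ) : krausMap K (vecMulVec v (star v)) =
      ∑ k, vecMulVec (K k *ᵥ v) (star (K k *ᵥ v)) := by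
  rw [krausMap_apply]
  refine Finset.sum_congr rfl fun k _ => ?_
  rw [mul_vecMulVec, Matrix.vecMulVec_mul, star_mulVec]

theorem krausMap_vecMulVec_mulVec_eq_zero_iff {ι : Type*} [Fintype ι] {a b : ℕ}
    (K : ι → Matrix (Fin b) (Fin a) ℂ) (v : Fin a → ℂ) (x : Fin b → ℂ) :
    krausMap K (vecMulVec v (star v)) *ᵥ x = 0 ↔ ∀ k, star x ⬝ᵥ (K k *ᵥ v) = 0 := by
  rw [krausMap_vecMulVec, sum_mulVec_eq_zero_iff fun _ _ => posSemidef_vecMulVec_self_star _]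
  simp only [Finset.mem_univ, true_imp_iff]
  refine forall_congr' fun k => ?_
  rw [← (posSemidef_vecMulVec_self_star _).dotProduct_mulVec_zero_iff, vecMulVec_mulVec,
    dotProduct_smul, MulOpposite.smul_eq_mul_unop, MulOpposite.unop_op, star_dotProduct (K k *ᵥ v)]
  simp

theorem vecMulVec_mem_densityOps {d : ℕ} {v : Fin d → ℂ} (hv : star v ⬝ᵥ v = 1) :
    vecMulVec v (star v) ∈ densityOps d :=
  ⟨posSemidef_vecMulVec_self_star _, by rw [trace_vecMulVec, dotProduct_comm, hv]⟩

theorem posSemidef_one_sub_vecMulVec {d : ℕ} {v : Fin d → ℂ} (hv : star v ⬝ᵥ v = 1) :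
    (1 - vecMulVec v (star v)).PosSemidef := by
  have h : (1 - vecMulVec v (star v))ᴴ * (1 - vecMulVec v (star v)) = 1 - vecMulVec v (star v) := by
    rw [conjTranspose_sub, conjTranspose_one, conjTranspose_vecMulVec, star_star, Matrix.mul_sub,
      Matrix.sub_mul, Matrix.sub_mul, Matrix.one_mul, Matrix.mul_one, Matrix.one_mul,
      vecMulVec_mul_vecMulVec, hv, one_smul, sub_self, sub_zero]
  exact h ▸ posSemidef_conjTranspose_mul_self _

/-- An orthonormal family of `d` vectors of `ℂ^d`. -/
def OrthonormalFamily {d : ℕ} (v : Fin d → Fin d → ℂ) : Prop :=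
  ∀ i j, star (v i) ⬝ᵥ v j = if i = j then 1 else 0

theorem orthonormalFamily_single (d : ℕ) :
    OrthonormalFamily fun i : Fin d => (Pi.single i (1 : ℂ) : Fin d → ℂ) := by
  intro i j
  simp [Pi.single_apply, eq_comm]

theorem exists_orthonormalFamily {d : ℕ} {x : Fin d → ℂ} (hx : x ≠ 0) (i₀ : Fin d) :
    ∃ v, OrthonormalFamily v ∧ ∃ c : ℂ, c • v i₀ = x := by
  have hy : WithLp.toLp 2 x ≠ 0 := by simpa using hx
  set y : EuclideanSpace ℂ (Fin d) := WithLp.toLp 2 x with hy_def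
  have ho : Orthonormal ℂ (({i₀} : Set (Fin d)).domRestrict fun _ => ((‖y‖⁻¹ : ℝ) : ℂ) • y) := by
    refine ⟨fun i => ?_, fun i j hij => (hij (Subsingleton.elim i j)).elim⟩
    simp [Set.domRestrict_apply, norm_smul, hy]
  obtain ⟨b, hb⟩ := ho.exists_orthonormalBasis_extension_of_card_eq (by simp)
  refine ⟨fun i => (b i).ofLp, fun i j => ?_, ‖y‖, ?_⟩
  · have := orthonormal_iff_ite.1 b.orthonormal i j
    rwa [EuclideanSpace.inner_eq_star_dotProduct, dotProduct_comm] at this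
  · change (‖y‖ : ℂ) • (b i₀).ofLp = x
    rw [hb i₀ rfl, ← WithLp.ofLp_smul, smul_smul, ← Complex.ofReal_mul,
      mul_inv_cancel₀ (norm_ne_zero_iff.2 hy), Complex.ofReal_one, one_smul]

/-- If the expansion coefficient does not vanish, no vector of an orthonormal family is mapped by
the Kraus operators into the span of the images of others. -/
theorem IsMonotoneFDivergence.exists_notMem_span (hD : IsMonotoneFDivergence f D)
    (hf : ClassF f) {ι : Type*} [Fintype ι] {a b : ℕ} {K : ι → Matrix (Fin b) (Fin a) ℂ}
    (hN : IsQuantumChannel (krausMap K)) (hne : ¬ expansionCoeff D (krausMap K) ≤ 0)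
    {v : Fin a → Fin a → ℂ} (hv : OrthonormalFamily v) {s : Finset (Fin a)} (hs : s.Nonempty)
    {j : Fin a} (hj : j ∉ s) :
    ∃ k, K k *ᵥ v j ∉ Submodule.span ℂ {y | ∃ l, ∃ i ∈ s, y = K l *ᵥ v i} := by
  by_contra! hcon
  have hvj : star (v j) ⬝ᵥ v j = 1 := by simpa using hv j j
  have hs0 : (s.card : ℝ) ≠ 0 := by exact_mod_cast hs.card_ne_zero
  have hs1 : 0 ≤ (s.card : ℝ)⁻¹ := by positivity
  set α : Op a := (s.card : ℝ)⁻¹ • ∑ i ∈ s, vecMulVec (v i) (star (v i)) with hα_def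
  have hα : α ∈ densityOps a := by
    refine ⟨(Matrix.posSemidef_sum _ fun i _ => posSemidef_vecMulVec_self_star _).smul hs1, ?_⟩
    rw [hα_def, trace_smul, trace_sum, Finset.sum_congr rfl fun i _ =>
      (vecMulVec_mem_densityOps (by simpa using hv i i)).2]
    simp [hs.card_ne_zero]
  -- The kernel of the image of α is the orthogonal complement of the span, so it annihilates every
  -- `K k *ᵥ v j` as well; domination follows.
  have hker : ∀ x, krausMap K α *ᵥ x = 0 → krausMap K (vecMulVec (v j) (star (v j))) *ᵥ x = 0 := by
    intro x hx
    rw [hα_def, LinearMap.map_smul_of_tower, smul_mulVec, smul_eq_zero_iff_right (inv_ne_zero hs0),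
      map_sum, sum_mulVec_eq_zero_iff fun i _ =>
        hN.map_posSemidef (posSemidef_vecMulVec_self_star _)] at hx
    rw [krausMap_vecMulVec_mulVec_eq_zero_iff]
    intro k
    have hmem := hcon k
    generalize K k *ᵥ v j = z at hmem ⊢
    induction hmem using Submodule.span_induction with
    | mem y hy =>
      obtain ⟨l, i, hi, rfl⟩ := hy
      exact (krausMap_vecMulVec_mulVec_eq_zero_iff K _ _).1 (hx i hi) l
    | zero => simp
    | add y z _ _ hy hz => rw [dotProduct_add, hy, hz, add_zero]
    | smul c y _ hy => rw [dotProduct_smul, hy, smul_zero]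
  obtain ⟨C, hC0, hC⟩ := exists_posSemidef_smul_sub
    (hN.map_posSemidef (posSemidef_vecMulVec_self_star (v j))) (hN.map_posSemidef hα.1) hker
  refine hne (hD.expansionCoeff_nonpos hf hN hα (vecMulVec_mem_densityOps hvj)
    (posSemidef_vecMulVec_self_star (v j)) (posSemidef_one_sub_vecMulVec hvj) ?_ ?_ hC0 hC)
  · rw [hα_def, Matrix.mul_smul, trace_smul, Finset.mul_sum, trace_sum, Finset.sum_eq_zero, smul_zero]
    intro i hi
    rw [vecMulVec_mul_vecMulVec, hv j i, if_neg fun h : j = i => hj (h ▸ hi)]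
    simp
  · rw [vecMulVec_mul_vecMulVec, hvj, one_smul]
    exact (vecMulVec_mem_densityOps hvj).2

/-- Each vector of `t` adds at least one dimension, by `exists_notMem_span`. -/
theorem IsMonotoneFDivergence.card_add_finrank_le (hD : IsMonotoneFDivergence f D)
    (hf : ClassF f) {ι : Type*} [Fintype ι] {a b : ℕ} {K : ι → Matrix (Fin b) (Fin a) ℂ}
    (hN : IsQuantumChannel (krausMap K)) (hne : ¬ expansionCoeff D (krausMap K) ≤ 0)
    {v : Fin a → Fin a → ℂ} (hv : OrthonormalFamily v) {s : Finset (Fin a)} (hs : s.Nonempty)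
    (t : Finset (Fin a)) (hst : Disjoint s t) :
    t.card + Module.finrank ℂ (Submodule.span ℂ {y | ∃ l, ∃ i ∈ s, y = K l *ᵥ v i}) ≤
      Module.finrank ℂ (Submodule.span ℂ {y | ∃ l, ∃ i ∈ s ∪ t, y = K l *ᵥ v i}) := by
  induction t using Finset.induction_on with
  | empty =>
    rw [Finset.card_empty, zero_add]
    exact Submodule.finrank_mono (Submodule.span_mono fun y ⟨l, i, hi, hy⟩ =>
      ⟨l, i, Finset.mem_union_left _ hi, hy⟩)
  | insert j t hj ih =>
    rw [Finset.disjoint_insert_right] at hst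
    rw [Finset.card_insert_of_notMem hj, add_right_comm]
    refine (Nat.succ_le_succ (ih hst.2)).trans
      (Nat.succ_le_of_lt (Submodule.finrank_lt_finrank_of_lt ?_))
    obtain ⟨k, hk⟩ := hD.exists_notMem_span hf hN hne hv (s := s ∪ t) (j := j)
      (hs.mono Finset.subset_union_left) (by simp [hst.1, hj])
    refine lt_of_le_of_ne (Submodule.span_mono ?_) fun heq => hk ?_
    · rintro y ⟨l, i, hi, rfl⟩
      exact ⟨l, i, by simp only [Finset.mem_union, Finset.mem_insert] at hi ⊢; tauto, rfl⟩
    · rw [heq]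
      exact Submodule.subset_span ⟨k, j, by simp, rfl⟩

/-- If the expansion coefficient does not vanish, the Kraus operators map each vector to a line. -/
theorem IsMonotoneFDivergence.exists_line (hD : IsMonotoneFDivergence f D)
    (hf : ClassF f) {ι : Type*} [Fintype ι] {a b : ℕ} (ha : 0 < a) (hba : b ≤ a)
    {K : ι → Matrix (Fin b) (Fin a) ℂ}
    (hN : IsQuantumChannel (krausMap K)) (hne : ¬ expansionCoeff D (krausMap K) ≤ 0)
    (x : Fin a → ℂ) : ∃ y, ∀ k, ∃ c : ℂ, K k *ᵥ x = c • y := by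
  rcases eq_or_ne x 0 with rfl | hx
  · exact ⟨0, fun k => ⟨0, by simp⟩⟩
  obtain ⟨v, hv, c, rfl⟩ := exists_orthonormalFamily hx ⟨0, ha⟩
  have h := hD.card_add_finrank_le hf hN hne hv (Finset.singleton_nonempty (⟨0, ha⟩ : Fin a))
    {⟨0, ha⟩}ᶜ disjoint_compl_right
  have h1 : Module.finrank ℂ (Submodule.span ℂ
      {y | ∃ l, ∃ i ∈ ({⟨0, ha⟩} : Finset (Fin a)) ∪ {⟨0, ha⟩}ᶜ, y = K l *ᵥ v i}) ≤ b :=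
    (Submodule.finrank_le _).trans (by simp)
  rw [Finset.card_compl, Fintype.card_fin, Finset.card_singleton] at h
  -- Now (a - 1) + dim ≤ b ≤ a, which leaves dim ≤ 1 for the line of `x`.
  have h2 := h.trans h1
  obtain ⟨y, hy⟩ := finrank_le_one_iff.1 (show Module.finrank ℂ (Submodule.span ℂ
    {y | ∃ l, ∃ i ∈ ({⟨0, ha⟩} : Finset (Fin a)), y = K l *ᵥ v i}) ≤ 1 by omega)
  refine ⟨y, fun k => ?_⟩
  obtain ⟨e, he⟩ := hy ⟨K k *ᵥ v ⟨0, ha⟩, Submodule.subset_span ⟨k, _, by simp, rfl⟩⟩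
  refine ⟨c * e, ?_⟩
  have he' : e • (y : Fin b → ℂ) = K k *ᵥ v ⟨0, ha⟩ := congrArg Subtype.val he
  rw [mulVec_smul, ← he', smul_smul]

/-- If the expansion coefficient does not vanish, all Kraus operators are multiples of one. -/
theorem IsMonotoneFDivergence.exists_kraus_eq_smul (hD : IsMonotoneFDivergence f D)
    (hf : ClassF f) {ι : Type*} [Fintype ι] {a b : ℕ} (ha : 2 ≤ a) (hba : b ≤ a)
    {K : ι → Matrix (Fin b) (Fin a) ℂ}
    (hN : IsQuantumChannel (krausMap K)) (hne : ¬ expansionCoeff D (krausMap K) ≤ 0) :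
    ∃ (L : Matrix (Fin b) (Fin a) ℂ) (w : ι → ℂ), ∀ k, K k = w k • L := by
  have : NeZero a := ⟨by omega⟩
  have : Nontrivial (Fin a) := Fin.nontrivial_iff_two_le.2 ha
  let e : Fin a → Fin a → ℂ := fun i => Pi.single i 1
  choose φ c hc using fun i => hD.exists_line hf (by omega) hba hN hne (e i)
  have hout : ∀ i j, i ≠ j →
      ∃ k, K k *ᵥ e j ∉ Submodule.span ℂ {y | ∃ l, ∃ i' ∈ ({i} : Finset (Fin a)), y = K l *ᵥ e i'} :=
    fun i j hij => hD.exists_notMem_span hf hN hne (orthonormalFamily_single a)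
      (Finset.singleton_nonempty i) (by simpa using hij.symm)
  have hc0 : ∀ i, ∃ k, c i k ≠ 0 := by
    intro i
    obtain ⟨j, hj⟩ := exists_ne i
    obtain ⟨k, hk⟩ := hout j i hj
    refine ⟨k, fun h => hk ?_⟩
    rw [hc, h, zero_smul]
    exact Submodule.zero_mem _
  -- If φ i and φ j were parallel, all Kraus images of e j would lie in the span of those of e i.
  have hind : ∀ i j, i ≠ j → LinearIndependent ℂ ![φ i, φ j] := by
    intro i j hij
    obtain ⟨k, hk⟩ := hout i j hij
    obtain ⟨l, hl⟩ := hc0 i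
    obtain ⟨m, hm⟩ := hout j i hij.symm
    have hφi : φ i ≠ 0 := fun h => hm (by rw [hc, h, smul_zero]; exact Submodule.zero_mem _)
    rw [LinearIndependent.pair_iff' hφi]
    intro t ht
    refine hk ?_
    rw [hc j k, ← ht]
    refine Submodule.smul_mem _ _ (Submodule.smul_mem _ _ ?_)
    rw [← inv_smul_smul₀ hl (φ i), ← hc i l]
    exact Submodule.smul_mem _ _ (Submodule.subset_span ⟨l, i, by simp, rfl⟩)
  -- The coefficient table has rank one: all images of e i + e j lie on one line, and φ i, φ j are
  -- independent.
  have hcross : ∀ i j, ∀ k l, c i k * c j l = c i l * c j k := by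
    intro i j k l
    rcases eq_or_ne i j with rfl | hij
    · ring
    obtain ⟨y, hy⟩ := hD.exists_line hf (by omega) hba hN hne (e i + e j)
    obtain ⟨p, hp⟩ := hy k
    obtain ⟨q, hq⟩ := hy l
    rw [mulVec_add, hc, hc] at hp hq
    have h0 : (q * c i k - p * c i l) • φ i + (q * c j k - p * c j l) • φ j = 0 := by
      have : q • (c i k • φ i + c j k • φ j) = p • (c i l • φ i + c j l • φ j) := by
        rw [hp, hq, smul_comm]
      rw [← sub_eq_zero] at this
      rw [← this]
      module
    obtain ⟨h1, h2⟩ := LinearIndependent.pair_iff.1 (hind i j hij) _ _ h0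
    by_cases hq0 : q = 0
    · obtain ⟨h3, h4⟩ := LinearIndependent.pair_iff.1 (hind i j hij) _ _
        (by rw [hq, hq0, zero_smul])
      rw [h3, h4, mul_zero, zero_mul]
    · apply mul_left_cancel₀ hq0
      linear_combination c j l * h1 - c i l * h2
  obtain ⟨k₀, hk₀⟩ := hc0 0
  refine ⟨K k₀, fun k => c 0 k / c 0 k₀, fun k => ?_⟩
  refine Matrix.ext_of_mulVec_single fun j => ?_
  change K k *ᵥ e j = _ *ᵥ e j
  rw [smul_mulVec, hc, hc, smul_smul]
  congr 1
  field_simp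
  linear_combination -hcross 0 j k k₀

/-! ### Unitarity and the two values of the coefficient -/

theorem isUnitaryChannel_of_kraus_eq_smul {ι : Type*} [Fintype ι] {a b : ℕ} (hba : b ≤ a)
    {K : ι → Matrix (Fin b) (Fin a) ℂ} (hN : IsQuantumChannel (krausMap K))
    {L : Matrix (Fin b) (Fin a) ℂ} {w : ι → ℂ} (h : ∀ k, K k = w k • L) :
    IsUnitaryChannel (krausMap K) := by
  set r : ℝ := ∑ k, ‖w k‖ ^ 2 with hr
  have hr0 : 0 ≤ r := by positivity
  set U : Matrix (Fin b) (Fin a) ℂ := ((Real.sqrt r : ℝ) : ℂ) • L with hU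
  have hconj : ∀ X, krausMap K X = U * X * Uᴴ := by
    intro X
    have h1 : ∀ k, K k * X * (K k)ᴴ = ((‖w k‖ ^ 2 : ℝ) : ℂ) • (L * X * Lᴴ) := fun k => by
      rw [h k, conjTranspose_smul, Matrix.smul_mul, Matrix.smul_mul, Matrix.mul_smul, smul_smul]
      congr 1
      simpa using Complex.mul_conj' (w k)
    rw [krausMap_apply, Finset.sum_congr rfl fun k _ => h1 k, ← Finset.sum_smul,
      ← Complex.ofReal_sum, ← hr, hU, conjTranspose_smul, Matrix.smul_mul, Matrix.smul_mul,
      Matrix.mul_smul, smul_smul]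
    congr 1
    simp [← Complex.ofReal_mul, Real.mul_self_sqrt hr0]
  have hUU : Uᴴ * U = 1 := by
    refine Matrix.ext_iff_trace_mul_right.2 fun X => ?_
    rw [Matrix.one_mul, ← hN.tracePreserving X, hconj, trace_mul_cycle U]
  -- An isometry from ℂ^a to ℂ^b has rank a ≤ b.
  have hab : a = b := by
    refine le_antisymm ?_ hba
    have h1 : (Uᴴ * U).rank = a := by rw [hUU, rank_one, Fintype.card_fin]
    rw [← h1]
    exact (rank_mul_le_right _ _).trans (rank_le_height U)
  subst hab
  exact ⟨rfl, U, hUU, mul_eq_one_comm.1 hUU, hconj⟩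

theorem IsMonotoneFDivergence.expansionCoeff_nonneg (hD : IsMonotoneFDivergence f D)
    (hf : ClassF f) {a b : ℕ} {N : Op a →ₗ[ℂ] Op b} (hN : IsQuantumChannel N) :
    0 ≤ expansionCoeff D N := by
  refine le_sInf ?_
  rintro _ ⟨ρ, hρ, γ, hγ, -, h, rfl⟩
  exact EReal.div_nonneg (hD.nonneg hf (hN.map_mem_densityOps hρ) (hN.map_mem_densityOps hγ)
    (hN.supp_map_eq hρ.1 hγ.1 h)) (hD.nonneg hf hρ hγ h)

/-- Ensures that the infimum is not over the empty set, where it would be ⊤. -/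
theorem exists_ne_supp_eq {d : ℕ} (hd : 2 ≤ d) :
    ∃ ρ ∈ densityOps d, ∃ γ ∈ densityOps d, ρ ≠ γ ∧ supp ρ = supp γ := by
  let v : Fin d → Fin d → ℂ := fun i => Pi.single i 1
  let i : Fin d := ⟨0, by omega⟩
  let j : Fin d := ⟨1, by omega⟩
  have hi := vecMulVec_mem_densityOps (v := v i) (by
    simp [v])
  have hj := vecMulVec_mem_densityOps (v := v j) (by
    simp [v])
  refine ⟨_, smul_add_smul_mem_densityOps (s := 1 / 3) (t := 2 / 3) hi hj (by norm_num)
    (by norm_num) (by norm_num), _, smul_add_smul_mem_densityOps (s := 2 / 3) (t := 1 / 3) hi hj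
    (by norm_num) (by norm_num) (by norm_num), fun h => ?_, supp_smul_add_smul hi.1 hj.1
    (by norm_num) (by norm_num) (by norm_num) (by norm_num)⟩
  have h1 := congrFun (congrFun h i) i
  simp [v, i, j, vecMulVec_apply] at h1
  norm_num [Complex.ext_iff] at h1

theorem IsMonotoneFDivergence.expansionCoeff_eq_one (hD : IsMonotoneFDivergence f D)
    (hf : ClassF f) {a b : ℕ} (ha : 2 ≤ a) {N : Op a →ₗ[ℂ] Op b} (hN : IsQuantumChannel N)
    (hU : IsUnitaryChannel N) : expansionCoeff D N = 1 := by
  obtain ⟨-, U, hU1, hU2, hNU⟩ := hU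
  obtain ⟨M, hM, hMX⟩ := conj_isQuantumChannel (U := Uᴴ) (by rwa [conjTranspose_conjTranspose])
  have hMN : ∀ X, M (N X) = X := fun X => by
    rw [hMX, hNU, conjTranspose_conjTranspose]
    calc Uᴴ * (U * X * Uᴴ) * U = (Uᴴ * U) * X * (Uᴴ * U) := by simp only [Matrix.mul_assoc]
      _ = X := by rw [hU1, Matrix.one_mul, Matrix.mul_one]
  have hratio : ∀ ρ ∈ densityOps a, ∀ γ ∈ densityOps a, ρ ≠ γ → supp ρ = supp γ →
      D b (N ρ) (N γ) / D a ρ γ = 1 := by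
    intro ρ hρ γ hγ hne h
    have h1 := hD.monotone a b N hN ρ hρ γ hγ h
    have h2 := hD.monotone b a M hM _ (hN.map_mem_densityOps hρ) _ (hN.map_mem_densityOps hγ)
      (hN.supp_map_eq hρ.1 hγ.1 h)
    rw [hMN, hMN] at h2
    rw [le_antisymm h1 h2]
    have hpos := hD.pos hf hρ hγ h hne
    -- Cancelling in `EReal` needs the divergence to be finite and nonzero.
    exact EReal.div_self (ne_bot_of_gt hpos) (hD.lt_top hρ hγ h).ne hpos.ne'
  obtain ⟨ρ, hρ, γ, hγ, hne, h⟩ := exists_ne_supp_eq ha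
  refine le_antisymm ?_ (le_sInf ?_)
  · rw [← hratio ρ hρ γ hγ hne h]
    exact sInf_le ⟨ρ, hρ, γ, hγ, hne, h, rfl⟩
  · rintro _ ⟨ρ, hρ, γ, hγ, hne, h, rfl⟩
    exact (hratio ρ hρ γ hγ hne h).ge

theorem IsMonotoneFDivergence.expansionCoeff_eq_zero (hD : IsMonotoneFDivergence f D)
    (hf : ClassF f) {a b : ℕ} (ha : 2 ≤ a) (hba : b ≤ a) {N : Op a →ₗ[ℂ] Op b}
    (hN : IsQuantumChannel N) (hU : ¬ IsUnitaryChannel N) : expansionCoeff D N = 0 := by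
  refine le_antisymm ?_ (hD.expansionCoeff_nonneg hf hN)
  by_contra hne
  obtain ⟨K, rfl⟩ := hN.exists_kraus
  obtain ⟨L, w, h⟩ := hD.exists_kraus_eq_smul hf ha hba hN hne
  exact hU (isUnitaryChannel_of_kraus_eq_smul hba hN h)

end QFDiv

theorem theorem3p1 (f : ℝ → ℝ) (hf : QFDiv.ClassF f)
    (D : (d : ℕ) → QFDiv.Op d → QFDiv.Op d → EReal) (hD : QFDiv.IsMonotoneFDivergence f D)
    (dA dB : ℕ) (hA : 2 ≤ dA) (hBA : dB ≤ dA)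
    (N : QFDiv.Op dA →ₗ[ℂ] QFDiv.Op dB) (hN : QFDiv.IsQuantumChannel N) :
    (QFDiv.IsUnitaryChannel N → QFDiv.expansionCoeff D N = 1) ∧
      (¬ QFDiv.IsUnitaryChannel N → QFDiv.expansionCoeff D N = 0) :=
  ⟨hD.expansionCoeff_eq_one hf hA hN, hD.expansionCoeff_eq_zero hf hA hBA hN⟩
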